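/- Let $G$ be a simple graph on a finite vertex set with $n$ vertices. A matching in $G$ is a set of vertex-disjoint edges, the matching number $\mathrm{match}(G)$ is the largest number of edges of a matching in $G$, and a full matching is a matching $M$ with $2|M|=n$ or $2|M|=n-1$. Let $S^-(G)$ be the set of all real skew-symmetric matrices $A=[a_{ij}]$, with rows and columns indexed by the vertices of $G$, such that for all vertices $i\neq j$, $a_{ij}\neq 0$ if and only if $\{i,j\}$ is an edge of $G$. A matrix is said to have distinct eigenvalues if its complex eigenvalues, counted with algebraic multiplicity, are pairwise distinct. 1. If $G$ is connected, then $G$ has a full matching if and only if there is a matrix $A\in S^-(G)$ with distinct eigenvalues; equivalently, $\mathrm{match}(G)=\lfloor n/2\rfloor$ if and only if there is a matrix $A\in S^-(G)$ with distinct eigenvalues. 2. If $G$ is a tree, then $\mathrm{match}(G)=\lfloor n/2\rfloor$ if and only if there is a real skew-symmetric matrix $A$ with distinct eigenvalues whose graph is $G$ (that is, $A\in S^-(G)$). -/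

import Mathlib

/-- The matching number: the number of edges of a maximum matching of `G`, a matching being a
set of vertex-disjoint edges. On a finite vertex type the set below is non-empty and bounded. -/
noncomputable def SimpleGraph.matchingNumber {V : Type*} (G : SimpleGraph V) : ℕ :=
  sSup {k : ℕ | ∃ M : G.Subgraph, M.IsMatching ∧ M.edgeSet.ncard = k}

/-- A full matching of a graph on `n` vertices is a matching `M` with `2|M| = n` or
`2|M| = n - 1`. -/
def SimpleGraph.HasFullMatching {V : Type*} [Fintype V] (G : SimpleGraph V) : Prop :=
  ∃ M : G.Subgraph, M.IsMatching ∧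
    (2 * M.edgeSet.ncard = Fintype.card V ∨ 2 * M.edgeSet.ncard + 1 = Fintype.card V)

/-- `S⁻(G)`: the real skew-symmetric matrices whose graph is `G`, that is, distinct vertices
`i`, `j` are adjacent in `G` exactly when the entry at `(i, j)` is nonzero. -/
def SimpleGraph.skewMatrices {V : Type*} (G : SimpleGraph V) : Set (Matrix V V ℝ) :=
  {A | A.transpose = -A ∧ ∀ i j : V, i ≠ j → (G.Adj i j ↔ A i j ≠ 0)}

/-- The eigenvalues in `ℂ` of a real square matrix, counted with algebraic multiplicity, are
pairwise distinct. -/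
def Matrix.HasDistinctEigenvalues {V : Type*} [Fintype V] [DecidableEq V]
    (A : Matrix V V ℝ) : Prop :=
  (A.map Complex.ofReal).charpoly.roots.Nodup

/-! From matching to matrix: put distinct positive weights on the matched edges. The skew matrix is
a direct sum of 2×2 blocks with eigenvalues `±I * f`, plus at most one zero, so its spectrum is
simple. Simplicity is the non-vanishing of a polynomial in the entries, so a generic perturbation
fills in the other edges and keeps it (`exists_mem_skewMatrices_hasDistinctEigenvalues`). From
matrix to matching: zero is at most a simple eigenvalue, so some principal block on at least `n - 1`
indices is nonsingular. Such a block stays nonsingular after deletion of both ends of a suitable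
edge (`exists_erase_erase`); peeling off edges until nothing is left matches all its indices. -/

/-! ### Separability and generic perturbation -/

open Polynomial in
/-- A real matrix has distinct complex eigenvalues iff its characteristic polynomial is separable. -/
theorem Matrix.hasDistinctEigenvalues_iff_separable {V : Type*} [Fintype V] [DecidableEq V]
    (A : Matrix V V ℝ) : A.HasDistinctEigenvalues ↔ A.charpoly.Separable := by
  have h : (A.map Complex.ofReal).charpoly = A.charpoly.map (algebraMap ℝ ℂ) :=
    Matrix.charpoly_map A (algebraMap ℝ ℂ)
  rw [Matrix.HasDistinctEigenvalues, h, ← Polynomial.aroots_def]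
  exact nodup_aroots_iff_of_splits A.charpoly_monic.ne_zero (IsAlgClosed.splits _)

open Polynomial in
/-- Along the line `A + t • B`, separability of the characteristic polynomial is the
non-vanishing of a polynomial in `t`. -/
theorem Matrix.exists_polynomial_eval_ne_zero_iff_charpoly_separable {V : Type*} [Fintype V]
    [DecidableEq V] (A B : Matrix V V ℝ) :
    ∃ R : ℝ[X], ∀ t : ℝ, R.eval t ≠ 0 ↔ (A + t • B).charpoly.Separable := by
  let N : Matrix V V ℝ[X] := A.map C + (X : ℝ[X]) • B.map C
  -- Fixing the degrees at `n` and `n - 1` lets the resultant commute with evaluation at `t`.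
  refine ⟨resultant N.charpoly (derivative N.charpoly) (Fintype.card V) (Fintype.card V - 1),
    fun t => ?_⟩
  have hN : N.map (evalRingHom t) = A + t • B := by
    ext i j
    simpa [N] using mul_comm _ _
  have hdeg : (A + t • B).charpoly.natDegree = Fintype.card V :=
    Matrix.charpoly_natDegree_eq_dim _
  rw [← coe_evalRingHom, ← resultant_map_map, ← derivative_map, ← Matrix.charpoly_map, hN,
    ← hdeg, ← natDegree_derivative, ← isUnit_iff_ne_zero,
    isUnit_resultant_iff_isCoprime (Matrix.charpoly_monic _), separable_def]

open Polynomial in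
/-- A skew-symmetric matrix with distinct eigenvalues and no nonzero entry outside the edges
of `G` can be perturbed to one whose graph is `G`. -/
theorem SimpleGraph.exists_mem_skewMatrices_hasDistinctEigenvalues {V : Type*} [Fintype V]
    [DecidableEq V] (G : SimpleGraph V) (A : Matrix V V ℝ) (hA : A.transpose = -A)
    (hG : ∀ i j, ¬ G.Adj i j → A i j = 0) (hd : A.HasDistinctEigenvalues) :
    ∃ A' ∈ G.skewMatrices, A'.HasDistinctEigenvalues := by
  classical
  let e := Fintype.equivFin V
  -- Differences of an injective labelling are skew and nonzero on every edge.
  let B : Matrix V V ℝ := Matrix.of fun i j => if G.Adj i j then ((e i : ℕ) : ℝ) - ((e j : ℕ) : ℝ) else 0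
  have hB : ∀ i j, G.Adj i j → B i j ≠ 0 := fun i j hij => by
    simp only [B, Matrix.of_apply, hij, if_true]
    rw [sub_ne_zero]
    intro h
    exact hij.ne (e.injective (Fin.ext (by exact_mod_cast h)))
  obtain ⟨R, hR⟩ := Matrix.exists_polynomial_eval_ne_zero_iff_charpoly_separable A B
  have hR0 : R ≠ 0 := by
    rintro rfl
    have := (hR 0).2 (by simpa using (Matrix.hasDistinctEigenvalues_iff_separable A).1 hd)
    simp at this
  -- A non-root of `P` gives separability and nonzero entries on all edges at once.
  let P : ℝ[X] := R * ∏ q : V × V, if G.Adj q.1 q.2 then C (A q.1 q.2) + X * C (B q.1 q.2) else 1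
  have hP : P ≠ 0 := by
    refine mul_ne_zero hR0 (Finset.prod_ne_zero_iff.2 fun q _ => ?_)
    split_ifs with hq
    · intro h
      have := congrArg (fun p : ℝ[X] => p.coeff 1) h
      simp at this
      exact hB _ _ hq this
    · exact one_ne_zero
  obtain ⟨t, ht⟩ : ∃ t, P.eval t ≠ 0 := by
    by_contra! h
    exact hP (Polynomial.funext (by simpa using h))
  simp only [P, eval_mul, eval_prod] at ht
  have ht1 := left_ne_zero_of_mul ht
  have ht2 := Finset.prod_ne_zero_iff.1 (right_ne_zero_of_mul ht)
  refine ⟨A + t • B, ⟨?_, fun i j hij => ?_⟩,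
    (Matrix.hasDistinctEigenvalues_iff_separable _).2 ((hR t).1 ht1)⟩
  · ext i j
    have h1 := congrFun (congrFun hA i) j
    simp only [Matrix.transpose_apply, Matrix.neg_apply] at h1
    simp only [Matrix.transpose_apply, Matrix.neg_apply, Matrix.add_apply, Matrix.smul_apply, h1,
      B, Matrix.of_apply, G.adj_comm j i, smul_eq_mul]
    split_ifs <;> ring
  · constructor
    · intro h
      have := ht2 (i, j) (Finset.mem_univ _)
      rw [if_pos h] at this
      simpa [mul_comm t] using this
    · intro h
      by_contra h'
      exact h (by simp [hG i j h', B, h'])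

/-! ### Matrices with simple spectrum from involutions -/

/-- If an involution `s` and an injective weight `f` satisfy `f ∘ s = -f`, then the skew-symmetric
matrix with entries `f i` at `(i, s i)` has the distinct eigenvalues `I * f i`. -/
theorem Matrix.hasDistinctEigenvalues_of_involutive {V : Type*} [Fintype V] [DecidableEq V]
    (s : V → V) (hs : Function.Involutive s) (f : V → ℝ) (hf : Function.Injective f)
    (hfs : ∀ v, f (s v) = -f v) :
    (Matrix.of fun i j => if j = s i then f i else 0 : Matrix V V ℝ).HasDistinctEigenvalues := by
  set A : Matrix V V ℝ := Matrix.of fun i j => if j = s i then f i else 0 with hA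
  set D : Matrix V V ℂ := A.map Complex.ofReal with hD
  have hmul : ∀ (x : V → ℂ) i, (D.mulVec x) i = f i * x (s i) := fun x i => by
    simp [hD, hA, Matrix.mulVec, dotProduct, apply_ite Complex.ofReal, ite_mul]
  have hroot : ∀ v, Complex.I * f v ∈ D.charpoly.roots := fun v => by
    rw [Polynomial.mem_roots D.charpoly_monic.ne_zero, ← Matrix.charpoly_toLin',
      ← Module.End.hasEigenvalue_iff_isRoot_charpoly]
    refine Module.End.hasEigenvalue_of_hasEigenvector
      -- At a fixed point of `s` this is `1 + I` times a basis vector, still nonzero, and there `f v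
      -- = 0`.
      (x := Pi.single v 1 + Pi.single (s v) Complex.I) ⟨?_, ?_⟩
    · rw [Module.End.mem_eigenspace_iff]
      ext i
      rw [Matrix.toLin'_apply, hmul]
      simp only [Pi.add_apply, Pi.single_apply, Pi.smul_apply, smul_eq_mul, hs.injective.eq_iff]
      have h1 : s i = v ↔ i = s v := hs.eq_iff
      simp only [h1]
      by_cases h2 : i = v
      · by_cases h3 : i = s v
        · subst h2
          have : f i = 0 := by
            have := hfs i
            rw [← h3] at this
            linarith
          simp [this]
        · subst h2
          simp [h3, mul_comm]
      · by_cases h3 : i = s v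
        · subst h3
          simp only [hfs, h2, if_true, if_false, Complex.ofReal_neg]
          linear_combination (-(f v : ℂ)) * Complex.I_mul_I
        · simp [h2, h3]
    · intro h
      have := congrFun h v
      simp only [Pi.add_apply, Pi.single_apply, Pi.zero_apply, if_true] at this
      split_ifs at this
      · simpa using congrArg Complex.re this
      · simp at this
  have hinj : Function.Injective fun v => Complex.I * (f v : ℂ) := fun v w h => by
    simpa [hf.eq_iff] using h
  have hle : (Finset.univ.val.map fun v => Complex.I * (f v : ℂ)) ≤ D.charpoly.roots := by
    rw [Multiset.le_iff_subset (Finset.univ.nodup.map hinj)]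
    intro z hz
    obtain ⟨v, -, rfl⟩ := Multiset.mem_map.1 hz
    exact hroot v
  have heq := Multiset.eq_of_le_of_card_le hle (by
    have := D.charpoly.card_roots'
    rw [Matrix.charpoly_natDegree_eq_dim] at this
    simpa using this)
  rw [Matrix.HasDistinctEigenvalues, ← hD, ← heq]
  exact Finset.univ.nodup.map hinj

/-- An involution with at most one fixed point has an injective real weight it negates. -/
theorem Function.Involutive.exists_injective_neg {V : Type*} [Finite V] (s : V → V)
    (hs : Function.Involutive s) (hfix : ∀ v w, s v = v → s w = w → v = w) :
    ∃ f : V → ℝ, Function.Injective f ∧ ∀ v, f (s v) = -f v := by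
  obtain ⟨n, ⟨e⟩⟩ := Finite.exists_equiv_fin V
  let g : V → ℕ := fun v => (e v : ℕ)
  have hg : Function.Injective g := fun v w h => e.injective (Fin.ext h)
  -- Each 2-cycle gets plus or minus its smaller label; the `+ 1` reserves zero for the fixed point.
  let f : V → ℤ := fun v =>
    if g v < g (s v) then (g v : ℤ) + 1 else if g (s v) < g v then -((g (s v) : ℤ) + 1) else 0
  have hf : Function.Injective f := fun v w h => by
    simp only [f] at h
    split_ifs at h
    any_goals omega
    · exact hg (by omega)
    · exact hs.injective (hg (by omega))
    · exact hfix v w (hg (by omega)) (hg (by omega))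
  refine ⟨fun v => f v, fun v w h => hf (Int.cast_injective h), fun v => ?_⟩
  have : f (s v) = -f v := by
    simp only [f, hs v]
    split_ifs <;> omega
  simp [this]

/-! ### Full matchings and the matrices they yield -/

/-- A matching covers twice as many vertices as it has edges. -/
theorem SimpleGraph.Subgraph.IsMatching.two_mul_ncard_edgeSet {V : Type*} [Finite V]
    {G : SimpleGraph V} {M : G.Subgraph} (hM : M.IsMatching) :
    2 * M.edgeSet.ncard = M.verts.ncard := by
  classical
  have := Fintype.ofFinite V
  have h := M.spanningCoe.sum_degrees_eq_twice_card_edges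
  have hd : ∀ v, M.spanningCoe.degree v = if v ∈ M.verts then 1 else 0 := fun v => by
    rw [SimpleGraph.Subgraph.degree_spanningCoe]
    split_ifs with hv
    · exact SimpleGraph.Subgraph.isMatching_iff_forall_degree.1 hM v hv
    · exact SimpleGraph.Subgraph.degree_of_notMem_verts hv
  rw [Finset.sum_congr rfl fun v _ => hd v] at h
  rw [← SimpleGraph.Subgraph.edgeSet_spanningCoe, ← SimpleGraph.coe_edgeFinset,
    Set.ncard_coe_finset, ← h, Set.ncard_eq_toFinset_card']
  simp

/-- A full matching is exactly one of `⌊n / 2⌋` edges, hence a maximum one. -/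
theorem SimpleGraph.hasFullMatching_iff_matchingNumber_eq {V : Type*} [Fintype V]
    (G : SimpleGraph V) : G.HasFullMatching ↔ G.matchingNumber = Fintype.card V / 2 := by
  have hle : ∀ M : G.Subgraph, M.IsMatching → 2 * M.edgeSet.ncard ≤ Fintype.card V :=
    fun M hM => by
      rw [hM.two_mul_ncard_edgeSet, ← Nat.card_eq_fintype_card]
      exact Set.ncard_le_card _
  have hbdd : ∀ k ∈ {k : ℕ | ∃ M : G.Subgraph, M.IsMatching ∧ M.edgeSet.ncard = k},
      k ≤ Fintype.card V / 2 := by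
    rintro k ⟨M, hM, rfl⟩
    have := hle M hM
    omega
  constructor
  · rintro ⟨M, hM, h⟩
    refine le_antisymm (csSup_le ⟨_, M, hM, rfl⟩ hbdd) ?_
    exact le_csSup ⟨_, hbdd⟩ ⟨M, hM, by omega⟩
  · intro h
    obtain ⟨M, hM, hk⟩ := Nat.sSup_mem (s := {k : ℕ | ∃ M : G.Subgraph, M.IsMatching ∧
      M.edgeSet.ncard = k}) ⟨_, ⊥, fun v hv => hv.elim, rfl⟩ ⟨_, hbdd⟩
    change M.edgeSet.ncard = G.matchingNumber at hk
    exact ⟨M, hM, by omega⟩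

/-- A graph with a full matching supports a skew-symmetric matrix with distinct eigenvalues. -/
theorem SimpleGraph.HasFullMatching.exists_hasDistinctEigenvalues {V : Type*} [Fintype V]
    [DecidableEq V] {G : SimpleGraph V} (h : G.HasFullMatching) :
    ∃ A ∈ G.skewMatrices, A.HasDistinctEigenvalues := by
  classical
  obtain ⟨M, hM, hcard⟩ := h
  have hM' : ∀ v, ∃ w, v ∈ M.verts → M.Adj v w := fun v => by
    by_cases hv : v ∈ M.verts
    · exact (hM hv).exists.imp fun _ h _ => h
    · exact ⟨v, fun h => (hv h).elim⟩
  choose p hp using hM'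
  let s : V → V := fun v => if v ∈ M.verts then p v else v
  have hs : Function.Involutive s := fun v => by
    by_cases hv : v ∈ M.verts
    · have h1 := hp v hv
      have h2 := M.edge_vert h1.symm
      simp only [s, hv, h2, if_true]
      exact hM.eq_of_adj_left (hp _ h2) h1.symm
    · simp [s, hv]
  have hadj : ∀ v, s v ≠ v → G.Adj v (s v) := fun v hv => by
    by_cases hv' : v ∈ M.verts
    · simpa [s, hv'] using (hp v hv').adj_sub
    · simp [s, hv'] at hv
  have hnot : ∀ v, s v = v → v ∈ M.vertsᶜ := fun v hv hv' => by
    simp only [s, hv', if_true] at hv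
    have := hp v hv'
    rw [hv] at this
    exact this.ne rfl
  have hcompl : M.vertsᶜ.ncard ≤ 1 := by
    have h1 := Set.ncard_add_ncard_compl M.verts
    have h2 := hM.two_mul_ncard_edgeSet
    rw [Nat.card_eq_fintype_card] at h1
    omega
  obtain ⟨f, hf, hfs⟩ := hs.exists_injective_neg s fun v w hv hw =>
    (Set.ncard_le_one (Set.toFinite _)).1 hcompl v (hnot v hv) w (hnot w hw)
  refine G.exists_mem_skewMatrices_hasDistinctEigenvalues _ ?_ (fun i j hij => ?_)
    (Matrix.hasDistinctEigenvalues_of_involutive s hs f hf hfs)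
  · ext i j
    simp only [Matrix.transpose_apply, Matrix.neg_apply, Matrix.of_apply]
    have h1 : i = s j ↔ j = s i := by rw [eq_comm, hs.eq_iff]
    by_cases h2 : j = s i
    · rw [if_pos (h1.2 h2), if_pos h2, h2, hfs]
    · rw [if_neg (mt h1.1 h2), if_neg h2, neg_zero]
  · simp only [Matrix.of_apply]
    split_ifs with h1
    · subst h1
      have h2 : s i = i := by
        by_contra h2
        exact hij (hadj i h2)
      have := hfs i
      rw [h2] at this
      linarith
    · rfl

/-! ### Nonsingular principal submatrices and extraction of a matching -/

/-- The principal submatrix of `A` on `S` has trivial kernel. -/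
def Matrix.NonsingularOn {V : Type*} [Fintype V] (A : Matrix V V ℝ) (S : Finset V) : Prop :=
  ∀ x : V → ℝ, (∀ i ∉ S, x i = 0) → (∀ i ∈ S, A.mulVec x i = 0) → x = 0

theorem Matrix.NonsingularOn.exists_mulVec_eq {V : Type*} [Fintype V] [DecidableEq V]
    {A : Matrix V V ℝ} {S : Finset V} (h : A.NonsingularOn S) (b : V → ℝ) :
    ∃ x : V → ℝ, (∀ i ∉ S, x i = 0) ∧ ∀ i ∈ S, A.mulVec x i = b i := by
  -- `A` on the rows in `S` and the identity elsewhere: injective, hence surjective.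
  let T : (V → ℝ) →ₗ[ℝ] (V → ℝ) :=
    { toFun := fun x i => if i ∈ S then A.mulVec x i else x i
      map_add' := fun x y => by
        ext i
        simp only [Matrix.mulVec_add, Pi.add_apply]
        split_ifs <;> rfl
      map_smul' := fun c x => by
        ext i
        simp only [Matrix.mulVec_smul, Pi.smul_apply, RingHom.id_apply]
        split_ifs <;> rfl }
  have hT : ∀ x i, T x i = if i ∈ S then A.mulVec x i else x i := fun _ _ => rfl
  have hinj : Function.Injective T := by
    rw [injective_iff_map_eq_zero]
    intro x hx
    refine h x (fun i hi => ?_) fun i hi => ?_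
    · simpa [hT, hi] using congrFun hx i
    · simpa [hT, hi] using congrFun hx i
  obtain ⟨x, hx⟩ := LinearMap.injective_iff_surjective.1 hinj fun i => if i ∈ S then b i else 0
  refine ⟨x, fun i hi => ?_, fun i hi => ?_⟩
  · simpa [hT, hi] using congrFun hx i
  · simpa [hT, hi] using congrFun hx i

theorem Matrix.dotProduct_mulVec_of_transpose_eq_neg {V : Type*} [Fintype V]
    {A : Matrix V V ℝ} (hA : A.transpose = -A) (x y : V → ℝ) :
    x ⬝ᵥ A.mulVec y = -(A.mulVec x ⬝ᵥ y) := by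
  rw [Matrix.dotProduct_mulVec, ← Matrix.mulVec_transpose, hA, Matrix.neg_mulVec, neg_dotProduct]

/-- A nonsingular principal submatrix of a skew-symmetric matrix loses two indices joined by a
nonzero entry and remains nonsingular. -/
theorem Matrix.NonsingularOn.exists_erase_erase {V : Type*} [Fintype V] [DecidableEq V]
    {A : Matrix V V ℝ} {S : Finset V} (h : A.NonsingularOn S) (hA : A.transpose = -A)
    {v : V} (hv : v ∈ S) :
    ∃ w ∈ S, w ≠ v ∧ A v w ≠ 0 ∧ A.NonsingularOn ((S.erase v).erase w) := by
  -- `y` is column `v` of the inverse of the block on `S`, extended by zero.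
  obtain ⟨y, hy0, hy⟩ := h.exists_mulVec_eq (Pi.single v 1)
  have hdot : ∀ z : V → ℝ, (∀ i ∉ S, z i = 0) → A.mulVec y ⬝ᵥ z = z v := fun z hz => by
    rw [dotProduct, Finset.sum_eq_single v]
    · simp [hy v hv]
    · intro i _ hi
      by_cases hiS : i ∈ S
      · simp [hy i hiS, hi]
      · simp [hz i hiS]
    · simp
  have hyv : y v = 0 := by
    have h1 := Matrix.dotProduct_mulVec_of_transpose_eq_neg hA y y
    rw [dotProduct_comm, hdot y hy0] at h1
    linarith
  obtain ⟨w, -, hw⟩ : ∃ w ∈ Finset.univ, A v w * y w ≠ 0 := by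
    apply Finset.exists_ne_zero_of_sum_ne_zero
    have := hy v hv
    simp only [Matrix.mulVec, dotProduct, Pi.single_eq_same] at this
    rw [this]
    exact one_ne_zero
  have hyw := right_ne_zero_of_mul hw
  have hwv : w ≠ v := fun h => hyw (h ▸ hyv)
  have hwS : w ∈ S := by
    by_contra h
    exact hyw (hy0 w h)
  refine ⟨w, hwS, hwv, left_ne_zero_of_mul hw, fun z hz0 hz => ?_⟩
  have hzv : z v = 0 := hz0 v (by simp)
  have hzw : z w = 0 := hz0 w (by simp)
  have hzS : ∀ i ∉ S, z i = 0 := fun i hi => hz0 i (by simp [hi])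
  have hz' : ∀ i ∈ S, i ≠ v → i ≠ w → A.mulVec z i = 0 := fun i hi h1 h2 =>
    hz i (by simp [hi, h1, h2])
  -- Skewness gives `y ⬝ᵥ A z = -z v = 0`, and only the `w` term of this sum survives.
  have hAzw : A.mulVec z w = 0 := by
    have h1 := Matrix.dotProduct_mulVec_of_transpose_eq_neg hA y z
    rw [hdot z hzS, hzv, neg_zero, dotProduct, Finset.sum_eq_single w] at h1
    · exact (mul_eq_zero.1 h1).resolve_left hyw
    · intro i _ hi
      by_cases hiS : i ∈ S
      · by_cases hiv : i = v
        · simp [hiv, hyv]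
        · simp [hz' i hiS hiv hi]
      · simp [hy0 i hiS]
    · simp
  -- On `S`, `A z` is now supported at `v`, so `z` is a multiple of `y`; since `z w = 0 ≠ y w`, the
  -- factor is zero.
  have hzy : z - A.mulVec z v • y = 0 := by
    refine h _ (fun i hi => by simp [hzS i hi, hy0 i hi]) fun i hi => ?_
    rw [Matrix.mulVec_sub, Matrix.mulVec_smul, Pi.sub_apply, Pi.smul_apply, hy i hi]
    by_cases hiv : i = v
    · simp [hiv]
    · by_cases hiw : i = w
      · simp [hiw, hAzw, hwv]
      · simp [hiv, hz' i hi hiv hiw]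
  have hc : A.mulVec z v = 0 := by
    have := congrFun hzy w
    simpa [hzw, hyw] using this
  simpa [hc] using hzy

/-- If the principal submatrix on `S` of a skew-symmetric matrix of `G` is nonsingular, then `G`
has a matching covering exactly `S`. -/
theorem Matrix.NonsingularOn.exists_isMatching {V : Type*} [Fintype V] [DecidableEq V]
    {G : SimpleGraph V} {A : Matrix V V ℝ} (hA : A ∈ G.skewMatrices) (S : Finset V)
    (h : A.NonsingularOn S) : ∃ M : G.Subgraph, M.IsMatching ∧ M.verts = S := by
  induction S using Finset.strongInduction with
  | H S ih =>
    obtain rfl | ⟨v, hv⟩ := S.eq_empty_or_nonempty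
    · exact ⟨⊥, fun v hv => hv.elim, by simp⟩
    obtain ⟨w, hw, hwv, hvw, hS⟩ := h.exists_erase_erase hA.1 hv
    have hadj : G.Adj v w := (hA.2 v w hwv.symm).2 hvw
    obtain ⟨M, hM, hMS⟩ := ih _
      ((Finset.erase_subset _ _).trans_ssubset (Finset.erase_ssubset hv)) hS
    have hM' := SimpleGraph.Subgraph.IsMatching.subgraphOfAdj hadj
    refine ⟨M ⊔ G.subgraphOfAdj hadj, hM.sup hM' ?_, ?_⟩
    · rw [hM.support_eq_verts, hM'.support_eq_verts, hMS, Set.disjoint_left]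
      intro i hi hi'
      simp at hi hi'
      tauto
    · ext i
      simp only [SimpleGraph.Subgraph.verts_sup, hMS, SimpleGraph.subgraphOfAdj_verts,
        Set.mem_union, Finset.mem_coe, Finset.mem_erase, Set.mem_insert_iff,
        Set.mem_singleton_iff]
      by_cases h1 : i = v
      · simp [h1, hv]
      · by_cases h2 : i = w
        · simp [h2, hw]
        · simp [h1, h2]

/-- A skew-symmetric matrix with a simple (or no) eigenvalue zero has a nonsingular principal
submatrix omitting at most one index. -/
theorem Matrix.HasDistinctEigenvalues.exists_nonsingularOn {V : Type*} [Fintype V]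
    [DecidableEq V] {A : Matrix V V ℝ} (hd : A.HasDistinctEigenvalues)
    (hA : A.transpose = -A) :
    ∃ S : Finset V, A.NonsingularOn S ∧ Fintype.card V ≤ S.card + 1 := by
  -- Geometric multiplicity is at most algebraic multiplicity.
  have hker : Module.finrank ℝ (Module.End.eigenspace A.toLin' 0) ≤ 1 := by
    refine (LinearMap.finrank_eigenspace_le _ _).trans ?_
    rw [Matrix.charpoly_toLin']
    exact Polynomial.rootMultiplicity_le_one_of_separable
      ((Matrix.hasDistinctEigenvalues_iff_separable A).1 hd) 0
  have hmem : ∀ x, x ∈ Module.End.eigenspace A.toLin' 0 ↔ A.mulVec x = 0 := fun x => by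
    simp
  by_cases h0 : ∀ x, A.mulVec x = 0 → x = 0
  · exact ⟨Finset.univ, fun x _ hx => h0 x (funext fun i => hx i (Finset.mem_univ i)),
      by simp⟩
  push Not at h0
  obtain ⟨x, hx, hx0⟩ := h0
  obtain ⟨v, hv⟩ := Function.ne_iff.1 hx0
  refine ⟨Finset.univ.erase v, fun y hy0 hy => ?_, ?_⟩
  · have hyv : y v = 0 := hy0 v (by simp)
    -- Pairing with the kernel vector `x`, where `x v ≠ 0`, recovers the deleted row, so `y` lies in
    -- the kernel line spanned by `x`.
    have hAyv : A.mulVec y v = 0 := by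
      have h1 := Matrix.dotProduct_mulVec_of_transpose_eq_neg hA x y
      rw [hx, zero_dotProduct, neg_zero, dotProduct, Finset.sum_eq_single v] at h1
      · exact (mul_eq_zero.1 h1).resolve_left hv
      · intro i _ hi
        simp [hy i (by simp [hi])]
      · simp
    have hAy : A.mulVec y = 0 := funext fun i => by
      by_cases hi : i = v
      · rw [hi, hAyv, Pi.zero_apply]
      · exact hy i (by simp [hi])
    obtain ⟨⟨u, hu⟩, hspan⟩ := finrank_le_one_iff.1 hker
    obtain ⟨a, ha⟩ := hspan ⟨x, (hmem x).2 hx⟩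
    obtain ⟨b, hb⟩ := hspan ⟨y, (hmem y).2 hAy⟩
    have ha' : a • u = x := congrArg Subtype.val ha
    have hb' : b • u = y := congrArg Subtype.val hb
    have hb0 : b = 0 := by
      have h1 : b * u v = 0 := by rw [← hyv, ← hb']; rfl
      refine (mul_eq_zero.1 h1).resolve_right fun h2 => hv ?_
      rw [← ha', Pi.smul_apply, h2, smul_zero, Pi.zero_apply]
    rw [← hb', hb0, zero_smul]
  · rw [Finset.card_erase_of_mem (Finset.mem_univ v), Finset.card_univ]
    omega

/-- A graph has a full matching iff some skew-symmetric matrix of it has distinct eigenvalues. -/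
theorem SimpleGraph.hasFullMatching_iff_exists_hasDistinctEigenvalues {V : Type*} [Fintype V]
    [DecidableEq V] (G : SimpleGraph V) :
    G.HasFullMatching ↔ ∃ A ∈ G.skewMatrices, A.HasDistinctEigenvalues := by
  refine ⟨fun h => h.exists_hasDistinctEigenvalues, ?_⟩
  rintro ⟨A, hA, hd⟩
  obtain ⟨S, hS, hcard⟩ := hd.exists_nonsingularOn hA.1
  obtain ⟨M, hM, hMS⟩ := hS.exists_isMatching hA
  refine ⟨M, hM, ?_⟩
  have h1 := hM.two_mul_ncard_edgeSet
  rw [hMS, Set.ncard_coe_finset] at h1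
  have h2 := S.card_le_univ
  omega

theorem mainTheorem4 {V : Type*} [Fintype V] [DecidableEq V] (G : SimpleGraph V) :
    (G.Connected →
      (G.HasFullMatching ↔ ∃ A ∈ G.skewMatrices, A.HasDistinctEigenvalues) ∧
      (G.matchingNumber = Fintype.card V / 2 ↔
        ∃ A ∈ G.skewMatrices, A.HasDistinctEigenvalues)) ∧
    (G.IsTree →
      (G.matchingNumber = Fintype.card V / 2 ↔
        ∃ A ∈ G.skewMatrices, A.HasDistinctEigenvalues)) := by
  have h := G.hasFullMatching_iff_exists_hasDistinctEigenvalues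
  have h' := G.hasFullMatching_iff_matchingNumber_eq.symm.trans h
  exact ⟨fun _ => ⟨h, h'⟩, fun _ => h'⟩
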